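/- Let $\mathbb K=\mathbb R$ or $\mathbb C$, let $X,Y$ be completely regular Hausdorff spaces and $E,F$ normed spaces over $\mathbb K$. Write $C(X,E)$ for the continuous functions $X\to E$, $C^*(X,E)$ for the bounded ones, $C(X)=C(X,\mathbb K)$, and $c(f)=\{x: f(x)\neq 0\}$. For $f\in C(X)$ let $f^{\beta X}:\beta X\to\mathbb K\cup\{\infty\}$ be its continuous extension to the Stone–Čech compactification. A subring $A\subset C(X)$ is *normal* if for all disjoint closed $K,L\subset\beta X$ there is $f\in A$ with $0\le f\le 1$, $f^{\beta X}=1$ on $K$ and $f^{\beta X}=0$ on $L$; it is *local* if every $f\in C(X)$ that coincides on some open neighbourhood of each point of $X$ with a member of $A$ belongs to $A$. Let $A(X,E)\subset C(X,E)$ and $A(Y,F)\subset C(Y,F)$ be additive subgroups such that one of the following holds. (a) There are normal local subrings $A\subset C(X)$ and $B\subset C(Y)$ such that $A(X,E)$ is an $A$-module and $A(Y,F)$ is a $B$-module under pointwise multiplication; moreover for every $x\in X$ there is $f\in A(X,E)$ with $f(x)\ne 0$, and for every $y\in Y$ there is $g\in A(Y,F)$ with $g(y)\neq 0$. (b) $E$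 and $F$ are infinite-dimensional, $A(X,E)=C^*(X,E)$ and $A(Y,F)=C^*(Y,F)$. Call an additive map $T$ between two such function spaces *separating* if $c(Tf)\cap c(Tg)=\emptyset$ whenever $c(f)\cap c(g)=\emptyset$, and *biseparating* if it is bijective and both $T$ and $T^{-1}$ are separating (no linearity is assumed). If there is a biseparating map $T:A(X,E)\to A(Y,F)$, then the Hewitt realcompactifications $\upsilon X$ and $\upsilon Y$ are homeomorphic, where $\upsilon X$ is the subspace of those $p\in\beta X$ at which the extension $f^{\beta X}:\beta X\to\mathbb R\cup\{\infty\}$ of every real-valued continuous function $f$ on $X$ is finite. -/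

import Mathlib

/-- The continuous extension `f^β : βX → 𝕜 ∪ {∞}` of a continuous function `f : X → 𝕜`. -/
noncomputable def betaExt {𝕜 : Type*} [RCLike 𝕜] {X : Type*} [TopologicalSpace X]
    (f : C(X, 𝕜)) : StoneCech X → OnePoint 𝕜 :=
  stoneCechExtend (g := fun x => (f x : OnePoint 𝕜))
    (OnePoint.continuous_coe.comp f.continuous)

/-- The Hewitt realcompactification `υX`: the subspace of `βX` of those points at which the
extension to `βX` of every real-valued continuous function on `X` is finite. -/
def HewittRealcompactification (X : Type*) [TopologicalSpace X] : Type _ :=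
  {p : StoneCech X // ∀ f : C(X, ℝ), betaExt f p ≠ OnePoint.infty}

instance (X : Type*) [TopologicalSpace X] : TopologicalSpace (HewittRealcompactification X) :=
  inferInstanceAs (TopologicalSpace {p : StoneCech X //
    ∀ f : C(X, ℝ), betaExt f p ≠ OnePoint.infty})

/-- The cozero set `c(f) = {x | f x ≠ 0}`. -/
def cozeroSet {X E : Type*} [TopologicalSpace X] [NormedAddCommGroup E] (f : C(X, E)) : Set X :=
  {x | f x ≠ 0}

/-- A separating map: additive, and sends functions with disjoint cozero sets to functions with
disjoint cozero sets. No linearity is required. -/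
structure IsSeparating {X Y E F : Type*} [TopologicalSpace X] [TopologicalSpace Y]
    [NormedAddCommGroup E] [NormedAddCommGroup F]
    {M : AddSubgroup C(X, E)} {N : AddSubgroup C(Y, F)} (T : M → N) : Prop where
  map_add : ∀ f g : M, T (f + g) = T f + T g
  disjoint : ∀ f g : M, cozeroSet (f : C(X, E)) ∩ cozeroSet (g : C(X, E)) = ∅ →
    cozeroSet (T f : C(Y, F)) ∩ cozeroSet (T g : C(Y, F)) = ∅

/-- A biseparating map: bijective, separating, and with separating inverse. -/
def IsBiseparating {X Y E F : Type*} [TopologicalSpace X] [TopologicalSpace Y]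
    [NormedAddCommGroup E] [NormedAddCommGroup F]
    {M : AddSubgroup C(X, E)} {N : AddSubgroup C(Y, F)} (T : M → N) : Prop :=
  ∃ hT : Function.Bijective T,
    IsSeparating T ∧ IsSeparating ((Equiv.ofBijective T hT).symm : N → M)

/-- A subring `A` of `C(X)` is normal if disjoint closed subsets `K`, `L` of `βX` are separated by
some `f ∈ A` with `0 ≤ f ≤ 1`, `f^β = 1` on `K` and `f^β = 0` on `L`. -/
def IsNormalSubring {𝕜 : Type*} [RCLike 𝕜] {X : Type*} [TopologicalSpace X]
    (A : NonUnitalSubring C(X, 𝕜)) : Prop :=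
  ∀ K L : Set (StoneCech X), IsClosed K → IsClosed L → Disjoint K L →
    ∃ f ∈ A, (∀ x, ∃ t ∈ Set.Icc (0 : ℝ) 1, f x = (t : 𝕜)) ∧
      (∀ p ∈ K, betaExt f p = ((1 : 𝕜) : OnePoint 𝕜)) ∧
      (∀ p ∈ L, betaExt f p = ((0 : 𝕜) : OnePoint 𝕜))

/-- A subring `A` of `C(X)` is local if every continuous function that agrees near each point with
some member of `A` belongs to `A`. -/
def IsLocalSubring {𝕜 : Type*} [RCLike 𝕜] {X : Type*} [TopologicalSpace X]
    (A : NonUnitalSubring C(X, 𝕜)) : Prop :=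
  ∀ f : C(X, 𝕜),
    (∀ x : X, ∃ U : Set X, IsOpen U ∧ x ∈ U ∧ ∃ g ∈ A, ∀ z ∈ U, f z = g z) → f ∈ A

/-- The additive group `M ⊆ C(X, E)` is a module over some normal local subring of `C(X, 𝕜)`
(with pointwise multiplication), and its members do not all vanish at any one point of `X`. -/
def IsNormalLocalModule (𝕜 : Type*) [RCLike 𝕜] {X E : Type*} [TopologicalSpace X]
    [NormedAddCommGroup E] [NormedSpace 𝕜 E] (M : AddSubgroup C(X, E)) : Prop :=
  ∃ A : NonUnitalSubring C(X, 𝕜), IsNormalSubring A ∧ IsLocalSubring A ∧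
    (∀ a ∈ A, ∀ f ∈ M, a • f ∈ M) ∧ (∀ x : X, ∃ f ∈ M, f x ≠ 0)

/-- The additive group `C*(X, E)` of bounded continuous functions. -/
def boundedMaps (X E : Type*) [TopologicalSpace X] [NormedAddCommGroup E] :
    AddSubgroup C(X, E) where
  carrier := {f | ∃ C : ℝ, ∀ x, ‖f x‖ ≤ C}
  zero_mem' := ⟨0, fun x => by simp⟩
  add_mem' := by
    rintro f g ⟨C, hC⟩ ⟨D, hD⟩
    exact ⟨C + D, fun x => (norm_add_le _ _).trans (add_le_add (hC x) (hD x))⟩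
  neg_mem' := by
    rintro f ⟨C, hC⟩
    exact ⟨C, fun x => by simpa using hC x⟩

/-! For each `y`, compactness of `βX` and cutoffs give a support point `h y ∈ βX`; since `T`
preserves disjointness, `T f y` depends only on `f` near `h y`. So `h` is continuous, and its
extension to `βY` is inverse to the one built from `T⁻¹` (`exists_homeomorph_isSupportMap`). This
homeomorphism `H` restricts to the realcompactifications once no real function on `X` is infinite at
`H y` for `y ∈ Y`, and symmetrically.

If `u` is infinite at `H y`, level bands of a shift of `|u|` give open sets `G m`, locally finite in
`X`, whose tails all accumulate at `H y` (`exists_isShellFamily`). Gluing over them yields a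
contradiction. For modules, multiply some `f` with `T f y ≠ 0` by a function equal to `m` on `G m`:
the image is `m • T f` on `H⁻¹(G m)`, hence unbounded near `y`. For bounded functions, take a
bounded 1-separated sequence `w m` in `F` and `f m = T⁻¹(w m)`. Either the tail of the `f m` is
uniformly bounded near the `G m`, and gluing gives an image taking the values `w m` arbitrarily
close to `y`; or a subsequence grows fast, and gluing the constants scaled by `2⁻ⁿ` gives a bounded
function with unbounded preimage. -/

/-- Disjoint cozero sets are mapped to disjoint cozero sets. -/
def PreservesDisjointness {X Y E F : Type*} [TopologicalSpace X] [TopologicalSpace Y]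
    [NormedAddCommGroup E] [NormedAddCommGroup F]
    {M : AddSubgroup C(X, E)} {N : AddSubgroup C(Y, F)} (T : M →+ N) : Prop :=
  ∀ f g : M, (∀ x, (f : C(X, E)) x = 0 ∨ (g : C(X, E)) x = 0) →
    ∀ y, (T f : C(Y, F)) y = 0 ∨ (T g : C(Y, F)) y = 0

/-- Every member of `M` can be cut off: kept unchanged on one closed subset of `βX` and made to
vanish on another closed subset disjoint from it. -/
def AdmitsCutoffs {X E : Type*} [TopologicalSpace X] [NormedAddCommGroup E]
    (M : AddSubgroup C(X, E)) : Prop :=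
  ∀ f ∈ M, ∀ K L : Set (StoneCech X), IsClosed K → IsClosed L → Disjoint K L →
    ∃ g ∈ M, (∀ x, f x = 0 → g x = 0) ∧ (∀ x, stoneCechUnit x ∈ K → g x = f x) ∧
      (∀ x, stoneCechUnit x ∈ L → g x = 0)

/-- The members of `M` do not all vanish at any one point. -/
def NowhereVanishing {X E : Type*} [TopologicalSpace X] [NormedAddCommGroup E]
    (M : AddSubgroup C(X, E)) : Prop :=
  ∀ x : X, ∃ f ∈ M, f x ≠ 0

/-- `h y` is a support point of `f ↦ T f y`: every neighbourhood of it contains the cozero set of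
some `f` with `T f y ≠ 0`. -/
def IsSupportMap {X Y E F : Type*} [TopologicalSpace X] [TopologicalSpace Y]
    [NormedAddCommGroup E] [NormedAddCommGroup F]
    {M : AddSubgroup C(X, E)} {N : AddSubgroup C(Y, F)} (T : M →+ N)
    (h : Y → StoneCech X) : Prop :=
  ∀ y, ∀ U : Set (StoneCech X), IsOpen U → h y ∈ U →
    ∃ f : M, (∀ x, (f : C(X, E)) x ≠ 0 → stoneCechUnit x ∈ U) ∧ (T f : C(Y, F)) y ≠ 0

/-! ### Support points and the homeomorphism of Stone–Čech compactifications -/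

section SupportMap

variable {X Y E F : Type*} [TopologicalSpace X] [TopologicalSpace Y]
  [NormedAddCommGroup E] [NormedAddCommGroup F]
  {M : AddSubgroup C(X, E)} {N : AddSubgroup C(Y, F)}

theorem exists_supportPoint {T : M →+ N} (hM : AdmitsCutoffs M)
    (y : Y) (hy : ∃ f : M, (T f : C(Y, F)) y ≠ 0) :
    ∃ p : StoneCech X, ∀ U : Set (StoneCech X), IsOpen U → p ∈ U →
      ∃ f : M, (∀ x, (f : C(X, E)) x ≠ 0 → stoneCechUnit x ∈ U) ∧ (T f : C(Y, F)) y ≠ 0 := by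
  by_contra! hcon
  obtain ⟨f₀, hf₀⟩ := hy
  let null : Set (StoneCech X) → Prop := fun U =>
    ∀ f : M, (∀ x, (f : C(X, E)) x ≠ 0 → stoneCechUnit x ∈ U) → (T f : C(Y, F)) y = 0
  have key : ∃ U : Set (StoneCech X), IsOpen U ∧ null U ∧ closure Set.univ ⊆ U := by
    refine isCompact_univ.induction_on
      (p := fun S => ∃ U : Set (StoneCech X), IsOpen U ∧ null U ∧ closure S ⊆ U) ?_ ?_ ?_ ?_
    · refine ⟨∅, isOpen_empty, fun f hf => ?_, by simp⟩
      have : f = 0 := by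
        ext x
        by_contra hx
        exact hf x hx
      simp [this]
    · rintro s t hst ⟨U, hU, hn, hs⟩
      exact ⟨U, hU, hn, (closure_mono hst).trans hs⟩
    · rintro s t ⟨U, hU, hnU, hsU⟩ ⟨V, hV, hnV, htV⟩
      obtain ⟨W, hW, hstW, hWUV⟩ := normal_exists_closure_subset
        (s := closure (s ∪ t)) (t := U ∪ V) isClosed_closure (hU.union hV)
        (by rw [closure_union]; exact Set.union_subset_union hsU htV)
      refine ⟨W, hW, fun f hf => ?_, hstW⟩
      -- Split `f = g + (f - g)` with the first summand supported in `U` and the second in `V`.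
      obtain ⟨g, hgM, hg0, hg1, hg2⟩ := hM f f.2 (closure W \ V) Uᶜ
        (isClosed_closure.sdiff hV) hU.isClosed_compl (by
          rw [Set.disjoint_compl_right_iff_subset]
          rintro p ⟨hpW, hpV⟩
          exact (hWUV hpW).resolve_right hpV)
      have h1 : (T ⟨g, hgM⟩ : C(Y, F)) y = 0 := hnU _ fun x hx => by
        by_contra hxU
        exact hx (hg2 x hxU)
      have h2 : (T (f - ⟨g, hgM⟩) : C(Y, F)) y = 0 := hnV _ fun x hx => by
        by_contra hxV
        refine hx ?_
        have hfg : (f : C(X, E)) x = g x := by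
          by_cases hfx : (f : C(X, E)) x = 0
          · rw [hfx, hg0 x hfx]
          · exact (hg1 x ⟨subset_closure (hf x hfx), hxV⟩).symm
        simp [hfg]
      simpa [map_sub, h1] using h2
    · intro p _
      obtain ⟨U, hU, hpU, hn⟩ := hcon p
      obtain ⟨V, hV, hpV, hVU⟩ := normal_exists_closure_subset (isClosed_singleton (x := p)) hU
        (Set.singleton_subset_iff.2 hpU)
      exact ⟨V, mem_nhdsWithin_of_mem_nhds (hV.mem_nhds (hpV rfl)), U, hU, hn, hVU⟩
  obtain ⟨U, -, hn, hU⟩ := key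
  exact hf₀ (hn f₀ fun x _ => hU (subset_closure trivial))

theorem exists_isSupportMap {T : M →+ N} (hM : AdmitsCutoffs M) (hN : NowhereVanishing N)
    (hT : Function.Surjective T) : ∃ h : Y → StoneCech X, IsSupportMap T h := by
  choose h hh using fun y : Y => exists_supportPoint (T := T) hM y (by
    obtain ⟨g, hg, hgy⟩ := hN y
    obtain ⟨f, hf⟩ := hT ⟨g, hg⟩
    exact ⟨f, by rwa [hf]⟩)
  exact ⟨h, hh⟩

namespace IsSupportMap

variable {T : M →+ N} {h : Y → StoneCech X}

/-- Some function supported in `U` has nonzero image at `y`; its cozero set misses that of `f`, so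
`T f` must vanish there. -/
theorem map_eq_zero (hh : IsSupportMap T h) (hT : PreservesDisjointness T) {f : M}
    {U : Set (StoneCech X)} (hU : IsOpen U)
    (hf : ∀ x, stoneCechUnit x ∈ U → (f : C(X, E)) x = 0) {y : Y} (hy : h y ∈ U) :
    (T f : C(Y, F)) y = 0 := by
  obtain ⟨g, hg, hgy⟩ := hh y U hU hy
  refine (hT f g (fun x => ?_) y).resolve_right hgy
  by_contra! hx
  exact hx.1 (hf x (hg x hx.2))

theorem map_congr (hh : IsSupportMap T h) (hT : PreservesDisjointness T) {f g : M}
    {U : Set (StoneCech X)} (hU : IsOpen U)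
    (hfg : ∀ x, stoneCechUnit x ∈ U → (f : C(X, E)) x = (g : C(X, E)) x)
    {y : Y} (hy : h y ∈ U) : (T f : C(Y, F)) y = (T g : C(Y, F)) y := by
  have := hh.map_eq_zero hT (f := f - g) hU (fun x hx => by simp [hfg x hx]) hy
  simpa [map_sub, sub_eq_zero] using this

theorem mem_closure (hh : IsSupportMap T h) (hT : PreservesDisjointness T) {f : M} {y : Y}
    (hy : (T f : C(Y, F)) y ≠ 0) :
    h y ∈ closure (stoneCechUnit '' {x | (f : C(X, E)) x ≠ 0}) := by
  by_contra hcl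
  refine hy (hh.map_eq_zero hT isClosed_closure.isOpen_compl (fun x hx => ?_) hcl)
  by_contra hfx
  exact hx (subset_closure ⟨x, hfx, rfl⟩)

theorem continuous (hh : IsSupportMap T h) (hT : PreservesDisjointness T) : Continuous h := by
  rw [continuous_iff_continuousAt]
  intro y U hU
  obtain ⟨U', hU'U, hU', hyU'⟩ := mem_nhds_iff.1 hU
  obtain ⟨V, hV, hyV, hVU⟩ := normal_exists_closure_subset (isClosed_singleton (x := h y)) hU'
    (Set.singleton_subset_iff.2 hyU')
  obtain ⟨g, hg, hgy⟩ := hh y V hV (hyV rfl)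
  have hev : ∀ᶠ y' in nhds y, (T g : C(Y, F)) y' ≠ 0 :=
    (T g : C(Y, F)).continuous.continuousAt.eventually_ne hgy
  refine Filter.mem_map.2 (hev.mono fun y' hy' => ?_)
  refine hU'U (hVU (closure_mono ?_ (hh.mem_closure hT hy')))
  rintro _ ⟨x, hx, rfl⟩
  exact hg x hx

end IsSupportMap

/-- If `y` were moved, cut an image nonzero at `y` down to a small neighbourhood of `y`. The cozero
set of its preimage accumulates at `h y`, and `k` sends that cozero set into the closure of the
cut-off support, away from the supposed image of `y`. -/
theorem stoneCechExtend_supportMap_leftInverse (e : M ≃+ N)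
    (he : PreservesDisjointness (e : M →+ N)) (he' : PreservesDisjointness (e.symm : N →+ M))
    (hN : AdmitsCutoffs N) {h : Y → StoneCech X} (hh : IsSupportMap (e : M →+ N) h)
    {k : X → StoneCech Y} (hk : IsSupportMap (e.symm : N →+ M) k) :
    Function.LeftInverse (stoneCechExtend (hk.continuous he'))
      (stoneCechExtend (hh.continuous he)) := by
  have hcont := continuous_stoneCechExtend (hk.continuous he')
  suffices hid : stoneCechExtend (hk.continuous he') ∘ stoneCechExtend (hh.continuous he) = id from
    congrFun hid
  refine stoneCech_hom_ext (hcont.comp (continuous_stoneCechExtend _)) continuous_id ?_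
  funext y
  simp only [Function.comp_apply, stoneCechExtend_stoneCechUnit, id]
  by_contra hne
  obtain ⟨W', W, hW', hW, hyW', hyW, hdisj⟩ := t2_separation hne
  obtain ⟨f, hf, hfy⟩ := hh y _ (hW'.preimage hcont) hyW'
  obtain ⟨g, hgN, -, hg1, hg2⟩ := hN (e f) (e f).2 {stoneCechUnit y} Wᶜ isClosed_singleton
    hW.isClosed_compl (by simpa using hyW)
  have hgy : (e (e.symm ⟨g, hgN⟩) : C(Y, F)) y ≠ 0 := by
    rw [e.apply_symm_apply]
    exact (hg1 y rfl).symm ▸ hfy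
  obtain ⟨_, hxU, x, hx, rfl⟩ := mem_closure_iff.1 (hh.mem_closure he hgy) _
    (hW'.preimage hcont) hyW'
  have hkx := hk.mem_closure he' (f := ⟨g, hgN⟩) hx
  have hcl : closure (stoneCechUnit '' {y | g y ≠ 0}) ⊆ W'ᶜ := by
    refine closure_minimal ?_ hW'.isClosed_compl
    rintro _ ⟨z, hz, rfl⟩
    refine hdisj.symm.subset_compl_right ?_
    by_contra hzW
    exact hz (hg2 z hzW)
  refine hcl hkx ?_
  simpa [stoneCechExtend_stoneCechUnit] using hxU

end SupportMap

/-! ### Extensions to `βX` and shells around a point at infinity -/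

theorem continuous_betaExt {𝕜 : Type*} [RCLike 𝕜] {X : Type*} [TopologicalSpace X]
    (f : C(X, 𝕜)) : Continuous (betaExt f) :=
  continuous_stoneCechExtend _

@[simp]
theorem betaExt_stoneCechUnit {𝕜 : Type*} [RCLike 𝕜] {X : Type*} [TopologicalSpace X]
    (f : C(X, 𝕜)) (x : X) : betaExt f (stoneCechUnit x) = (f x : OnePoint 𝕜) :=
  stoneCechExtend_stoneCechUnit _ _

/-- A sequence `G m` of open subsets of `βX` with closures in pairwise disjoint open sets `P m`
which are locally finite in `X`. -/
structure IsShellFamily {X : Type*} [TopologicalSpace X] (G P : ℕ → Set (StoneCech X)) :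
    Prop where
  isOpen_inner : ∀ m, IsOpen (G m)
  isOpen_outer : ∀ m, IsOpen (P m)
  closure_subset : ∀ m, closure (G m) ⊆ P m
  disjoint : ∀ m n p, p ∈ P m → p ∈ P n → m = n
  locallyFinite : ∀ x : X, ∃ U : Set X, IsOpen U ∧ x ∈ U ∧
    ∀ m n, ∀ z ∈ U, ∀ z' ∈ U, stoneCechUnit z ∈ P m → stoneCechUnit z' ∈ P n → m = n

section Shells

variable {X : Type*} [TopologicalSpace X]

theorem isShellFamily_levels (u : C(X, ℝ)) :
    IsShellFamily
      (fun m : ℕ => betaExt u ⁻¹' (OnePoint.some '' Set.Ioo (4 * m : ℝ) (4 * m + 3)))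
      (fun m : ℕ => betaExt u ⁻¹' (OnePoint.some '' Set.Ioo (4 * m - 1 / 4 : ℝ)
        (4 * m + 3 + 1 / 4))) := by
  -- Consecutive widened bands are `1/2` apart, so values less than `1/2` apart lie in the same
  -- band.
  have hopen : ∀ a b : ℝ, IsOpen (betaExt u ⁻¹' (OnePoint.some '' Set.Ioo a b)) := fun a b =>
    (OnePoint.isOpenEmbedding_coe.isOpenMap _ isOpen_Ioo).preimage (continuous_betaExt u)
  have hsep : ∀ (m n : ℕ) (s t : ℝ), s ∈ Set.Ioo (4 * m - 1 / 4 : ℝ) (4 * m + 3 + 1 / 4) →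
      t ∈ Set.Ioo (4 * n - 1 / 4 : ℝ) (4 * n + 3 + 1 / 4) → s - t < 1 / 2 → t - s < 1 / 2 →
      m = n := by
    rintro m n s t ⟨h1, h2⟩ ⟨h3, h4⟩ h5 h6
    have h7 : (m : ℝ) < n + 1 := by linarith
    have h8 : (n : ℝ) < m + 1 := by linarith
    norm_cast at h7 h8
    omega
  refine ⟨fun m => hopen _ _, fun m => hopen _ _, fun m => ?_, ?_, fun x => ?_⟩
  · refine (closure_minimal (t := betaExt u ⁻¹' (OnePoint.some '' Set.Icc (4 * m : ℝ) (4 * m + 3)))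
      (Set.preimage_mono (Set.image_mono Set.Ioo_subset_Icc_self)) ?_).trans
      (Set.preimage_mono (Set.image_mono ?_))
    · exact (OnePoint.isClosed_image_coe.2 ⟨isClosed_Icc, isCompact_Icc⟩).preimage
        (continuous_betaExt u)
    · rintro t ⟨h1, h2⟩
      exact ⟨by linarith, by linarith⟩
  · rintro m n p ⟨s, hs, hsp⟩ ⟨t, ht, htp⟩
    have : s = t := OnePoint.coe_injective (hsp.trans htp.symm)
    subst this
    exact hsep m n s s hs ht (by norm_num) (by norm_num)
  · refine ⟨{z | |u z - u x| < 1 / 4}, isOpen_lt (by fun_prop) continuous_const, by simp, ?_⟩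
    rintro m n z hz z' hz' ⟨s, hs, hsz⟩ ⟨t, ht, htz⟩
    rw [betaExt_stoneCechUnit] at hsz htz
    obtain rfl := OnePoint.coe_injective hsz
    obtain rfl := OnePoint.coe_injective htz
    simp only [Set.mem_ofPred_eq, abs_lt] at hz hz'
    exact hsep m n _ _ hs ht (by linarith) (by linarith)

theorem mem_closure_iUnion_levels {u : C(X, ℝ)} {p : StoneCech X}
    (hu : betaExt u p = OnePoint.infty) {V : Set (StoneCech X)} (hpV : p ∈ closure V)
    (hV : ∀ x, stoneCechUnit x ∈ V → ∃ m : ℕ, u x ∈ Set.Ioo (4 * m : ℝ) (4 * m + 3))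
    (hVo : IsOpen V) (N : ℕ) :
    p ∈ closure (⋃ m ≥ N, betaExt u ⁻¹' (OnePoint.some '' Set.Ioo (4 * m : ℝ) (4 * m + 3))) := by
  rw [mem_closure_iff]
  intro W hW hpW
  -- Removing a compact range of values, which is harmless as `u` is infinite at `p`, discards the
  -- bands below `N`.
  have hK : IsOpen (betaExt u ⁻¹' (OnePoint.some '' Set.Icc (-(4 * N + 3) : ℝ) (4 * N + 3))ᶜ) :=
    (OnePoint.isClosed_image_coe.2 ⟨isClosed_Icc, isCompact_Icc⟩).isOpen_compl.preimage
      (continuous_betaExt u)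
  have hpK : p ∈ betaExt u ⁻¹' (OnePoint.some '' Set.Icc (-(4 * N + 3) : ℝ) (4 * N + 3))ᶜ := by
    simp [hu]
  have hne := mem_closure_iff.1 hpV _ (hW.inter hK) ⟨hpW, hpK⟩
  obtain ⟨_, ⟨⟨hxW, hxK⟩, hxV⟩, x, rfl⟩ := denseRange_stoneCechUnit.inter_open_nonempty _
    ((hW.inter hK).inter hVo) hne
  obtain ⟨m, hm⟩ := hV x hxV
  refine ⟨_, hxW, Set.mem_biUnion (x := m) ?_ ⟨u x, hm, by simp⟩⟩
  by_contra hmN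
  refine hxK ⟨u x, ⟨?_, ?_⟩, by simp⟩
  · have := hm.1
    have : (0 : ℝ) ≤ m := m.cast_nonneg
    have : (0 : ℝ) ≤ N := N.cast_nonneg
    linarith
  · have := hm.2
    have : (m : ℝ) ≤ N := by exact_mod_cast (not_le.1 hmN).le
    linarith

/-- A proper map of the line extends to the one-point compactification fixing `∞`. -/
theorem betaExt_comp_eq_infty {p : StoneCech X} {u v : C(X, ℝ)} {φ : ℝ → ℝ} (hφ : Continuous φ)
    (hφ' : Filter.Tendsto φ (Filter.cocompact ℝ) (Filter.cocompact ℝ)) (hv : ∀ x, v x = φ (u x))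
    (hu : betaExt u p = OnePoint.infty) : betaExt v p = OnePoint.infty := by
  have h : betaExt v = OnePoint.map φ ∘ betaExt u := by
    refine stoneCech_hom_ext (continuous_betaExt v)
      ((OnePoint.continuous_map hφ (by simpa using hφ')).comp (continuous_betaExt u)) ?_
    funext x
    simp [hv]
  simp [h, hu]

theorem exists_isShellFamily {p : StoneCech X} {u : C(X, ℝ)}
    (hu : betaExt u p = OnePoint.infty) :
    ∃ G P : ℕ → Set (StoneCech X), IsShellFamily G P ∧
      ∀ N : ℕ, p ∈ closure (⋃ m ≥ N, G m) := by
  have htend : ∀ c : ℝ, Filter.Tendsto (fun t : ℝ => |t| - c) (Filter.cocompact ℝ)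
      (Filter.cocompact ℝ) := fun c =>
    (Filter.tendsto_atTop_add_const_right _ (-c)
      (tendsto_norm_cocompact_atTop (E := ℝ))).mono_right atTop_le_cocompact
  let v : ℝ → C(X, ℝ) := fun c => ⟨fun x => |u x| - c, by fun_prop⟩
  have hv : ∀ c, betaExt (v c) p = OnePoint.infty := fun c =>
    betaExt_comp_eq_infty (φ := fun t => |t| - c) (by fun_prop) (htend c) (fun x => rfl) hu
  let V : ℝ → Set (StoneCech X) := fun c =>
    betaExt (v c) ⁻¹' (OnePoint.some '' ⋃ m : ℕ, Set.Ioo (4 * m : ℝ) (4 * m + 3))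
  have hVo : ∀ c, IsOpen (V c) := fun c =>
    (OnePoint.isOpenEmbedding_coe.isOpenMap _ (isOpen_iUnion fun m => isOpen_Ioo)).preimage
      (continuous_betaExt _)
  have hVm : ∀ c x, stoneCechUnit x ∈ V c ↔
      ∃ m : ℕ, v c x ∈ Set.Ioo (4 * m : ℝ) (4 * m + 3) := by
    intro c x
    simp only [V, Set.mem_preimage, betaExt_stoneCechUnit]
    rw [OnePoint.coe_injective.mem_set_image, Set.mem_iUnion]
  -- The bands `(4m, 4m+3)` and their translates by 2 together cover the positive reals, so `p`
  -- adheres to one of the two families.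
  have hp : p ∈ closure (V 0 ∪ V 2) := by
    rw [mem_closure_iff]
    intro W hW hpW
    have hK : IsOpen (betaExt u ⁻¹' (OnePoint.some '' {(0 : ℝ)})ᶜ) :=
      (OnePoint.isClosed_image_coe.2 ⟨isClosed_singleton, isCompact_singleton⟩).isOpen_compl.preimage
        (continuous_betaExt u)
    obtain ⟨_, ⟨hxW, hxK⟩, x, rfl⟩ := denseRange_stoneCechUnit.inter_open_nonempty _
      (hW.inter hK) ⟨p, hpW, by simp [hu]⟩
    refine ⟨_, hxW, ?_⟩
    have hx : 0 < |u x| := by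
      refine abs_pos.2 fun h0 => hxK ?_
      simp [h0]
    have h1 : ((⌊|u x| / 4⌋₊ : ℕ) : ℝ) ≤ |u x| / 4 := Nat.floor_le (by positivity)
    have h2 : |u x| / 4 < (⌊|u x| / 4⌋₊ : ℕ) + 1 := Nat.lt_floor_add_one _
    generalize ⌊|u x| / 4⌋₊ = n at h1 h2
    rw [Set.mem_union, hVm, hVm]
    change (∃ m : ℕ, |u x| - 0 ∈ _) ∨ (∃ m : ℕ, |u x| - 2 ∈ _)
    rcases h1.eq_or_lt with h | h
    · obtain _ | k := n
      · exfalso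
        rw [Nat.cast_zero] at h
        linarith
      · refine Or.inr ⟨k, ?_, ?_⟩ <;> push_cast at h <;> linarith
    · by_cases h3 : |u x| < 4 * n + 3
      · exact Or.inl ⟨n, by linarith, by linarith⟩
      · exact Or.inr ⟨n, by linarith, by linarith⟩
  rw [closure_union] at hp
  obtain ⟨c, hc⟩ : ∃ c, p ∈ closure (V c) := hp.elim (fun h => ⟨0, h⟩) (fun h => ⟨2, h⟩)
  exact ⟨_, _, isShellFamily_levels (v c), fun N =>
    mem_closure_iUnion_levels (hv c) hc (fun x hx => (hVm c x).1 hx) (hVo c) N⟩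

end Shells

/-! ### Continuous sums of disjointly supported functions -/

section Gluing

variable {X V : Type*} [TopologicalSpace X] [NormedAddCommGroup V]

/-- A locally finite family with pairwise disjoint cozero sets has a continuous sum. -/
theorem IsShellFamily.exists_glue {G P : ℕ → Set (StoneCech X)} (hGP : IsShellFamily G P)
    (f : ℕ → C(X, V)) (hf : ∀ m x, stoneCechUnit x ∉ P m → f m x = 0) :
    ∃ g : C(X, V), (∀ m x, stoneCechUnit x ∈ P m → g x = f m x) ∧
      ∀ x, ∃ U : Set X, IsOpen U ∧ x ∈ U ∧ ∃ m, ∀ z ∈ U, g z = f m z := by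
  have hval : ∀ m x, (∀ n, n ≠ m → f n x = 0) → ∑' n, f n x = f m x := fun m x h =>
    tsum_eq_single m h
  have hloc : ∀ x, ∃ U : Set X, IsOpen U ∧ x ∈ U ∧ ∃ m, ∀ z ∈ U, ∑' n, f n z = f m z := by
    intro x
    obtain ⟨U, hU, hxU, hUm⟩ := hGP.locallyFinite x
    refine ⟨U, hU, hxU, ?_⟩
    by_cases hex : ∃ m, ∃ z ∈ U, stoneCechUnit z ∈ P m
    · obtain ⟨m, z, hzU, hz⟩ := hex
      exact ⟨m, fun z' hz' => hval m z' fun n hn => hf n z' fun hnz =>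
        hn (hUm n m z' hz' z hzU hnz hz)⟩
    · push Not at hex
      -- No shell meets `U`, so all terms vanish there and any index serves.
      exact ⟨0, fun z hz => hval 0 z fun n _ => hf n z (hex n z hz)⟩
  refine ⟨⟨fun x => ∑' n, f n x, ?_⟩, fun m x hx => hval m x fun n hn => hf n x fun hnx =>
    hn (hGP.disjoint n m _ hnx hx), hloc⟩
  rw [continuous_iff_continuousAt]
  intro x
  obtain ⟨U, hU, hxU, m, hm⟩ := hloc x
  exact ((f m).continuous.continuousAt).congr
    (Filter.eventually_of_mem (hU.mem_nhds hxU) fun z hz => (hm z hz).symm)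

/-- A sequence of continuous functions with pairwise disjoint cozero sets that tends uniformly to
zero has a continuous sum. -/
theorem exists_continuousMap_of_disjoint (f : ℕ → C(X, V)) (r : ℕ → ℝ)
    (hr : Filter.Tendsto r Filter.atTop (nhds 0)) (hfr : ∀ n x, ‖f n x‖ ≤ r n)
    (hf : ∀ m n x, f m x ≠ 0 → f n x ≠ 0 → m = n) :
    ∃ g : C(X, V), ∀ x, (∀ n, f n x ≠ 0 → g x = f n x) ∧ ((∀ n, f n x = 0) → g x = 0) := by
  have hval : ∀ n x, f n x ≠ 0 → ∑' m, f m x = f n x := fun n x h =>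
    tsum_eq_single n fun m hm => by
      by_contra hmx
      exact hm (hf m n x hmx h)
  refine ⟨⟨fun x => ∑' n, f n x, ?_⟩, fun x => ⟨fun n => hval n x, fun h => (tsum_congr h).trans tsum_zero⟩⟩
  have hunif : TendstoUniformly (fun n x => ∑ i ∈ Finset.range n, f i x)
      (fun x => ∑' n, f n x) Filter.atTop := by
    rw [Metric.tendstoUniformly_iff]
    intro ε hε
    obtain ⟨N, hN⟩ := Filter.eventually_atTop.1 (hr.eventually_lt_const hε)
    filter_upwards [Filter.eventually_ge_atTop N] with n hn x
    by_cases hex : ∃ m, f m x ≠ 0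
    · obtain ⟨m, hm⟩ := hex
      have hzero : ∀ i, i ≠ m → f i x = 0 := fun i hi => by
        by_contra hix
        exact hi (hf i m x hix hm)
      rw [hval m x hm]
      by_cases hmn : m < n
      · rw [Finset.sum_eq_single m (fun i _ hi => hzero i hi)
          (fun h => absurd (Finset.mem_range.2 hmn) h), dist_self]
        exact hε
      · rw [Finset.sum_eq_zero fun i hi => hzero i fun him => hmn (him ▸ Finset.mem_range.1 hi),
          dist_zero_right]
        exact (hfr m x).trans_lt (hN m (hn.trans (not_lt.1 hmn)))
    · push Not at hex
      simpa [hex] using hε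
  exact hunif.continuous (Filter.Frequently.of_forall fun n =>
    continuous_finsetSum _ fun i _ => (f i).continuous)

end Gluing

/-! ### Transfer from `βX` and `βY` to the realcompactifications -/

section Homeomorph

variable {X Y : Type*} [TopologicalSpace X] [TopologicalSpace Y]

theorem mem_closure_preimage_of_homeomorph [CompletelyRegularSpace Y]
    (H : StoneCech Y ≃ₜ StoneCech X) {D : Set (StoneCech X)} (hD : IsOpen D) {y : Y}
    (hy : H (stoneCechUnit y) ∈ closure D) :
    y ∈ closure {z : Y | H (stoneCechUnit z) ∈ D} := by
  rw [mem_closure_iff]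
  intro W hW hyW
  obtain ⟨W', hW', rfl⟩ := isInducing_stoneCechUnit.isOpen_iff.1 hW
  obtain ⟨p, hpW, hpD⟩ := mem_closure_iff.1 hy (H.symm ⁻¹' W') (hW'.preimage H.symm.continuous)
    (by simpa using hyW)
  obtain ⟨_, ⟨hzW, hzD⟩, z, rfl⟩ := denseRange_stoneCechUnit.inter_open_nonempty _
    (hW'.inter (hD.preimage H.continuous)) ⟨H.symm p, hpW, by simpa using hpD⟩
  exact ⟨z, hzW, hzD⟩

/-- Finiteness on `Y` makes `u^β ∘ H` restrict to a real continuous function on `Y`, whose extension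
is `u^β ∘ H` by density. -/
theorem betaExt_ne_infty_of_homeomorph (H : StoneCech Y ≃ₜ StoneCech X)
    (hH : ∀ (y : Y) (u : C(X, ℝ)), betaExt u (H (stoneCechUnit y)) ≠ OnePoint.infty)
    {p : StoneCech Y} (hp : ∀ w : C(Y, ℝ), betaExt w p ≠ OnePoint.infty) (u : C(X, ℝ)) :
    betaExt u (H p) ≠ OnePoint.infty := by
  choose w hw using fun y => OnePoint.ne_infty_iff_exists.1 (hH y u)
  have hcont : Continuous w := by
    rw [OnePoint.isOpenEmbedding_coe.isInducing.continuous_iff]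
    have : OnePoint.some ∘ w = betaExt u ∘ H ∘ stoneCechUnit := funext hw
    rw [this]
    exact (continuous_betaExt u).comp (H.continuous.comp continuous_stoneCechUnit)
  have hext : betaExt ⟨w, hcont⟩ = betaExt u ∘ H := by
    refine stoneCech_hom_ext (continuous_betaExt _)
      ((continuous_betaExt u).comp H.continuous) ?_
    funext y
    simp [hw]
  have := hp ⟨w, hcont⟩
  rwa [hext] at this

theorem nonempty_homeomorph_hewittRealcompactification (H : StoneCech Y ≃ₜ StoneCech X)
    (hH : ∀ (y : Y) (u : C(X, ℝ)), betaExt u (H (stoneCechUnit y)) ≠ OnePoint.infty)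
    (hH' : ∀ (x : X) (w : C(Y, ℝ)), betaExt w (H.symm (stoneCechUnit x)) ≠ OnePoint.infty) :
    Nonempty (HewittRealcompactification X ≃ₜ HewittRealcompactification Y) :=
  ⟨H.symm.subtype fun p => ⟨fun hp => betaExt_ne_infty_of_homeomorph H.symm hH' hp, fun hp => by
    simpa using betaExt_ne_infty_of_homeomorph H hH hp⟩⟩

end Homeomorph

/-! ### Cutoffs in the two classes of function spaces -/

section Modules

variable {𝕜 : Type*} [RCLike 𝕜] {X : Type*} [TopologicalSpace X]

theorem IsNormalSubring.exists_bump {A : NonUnitalSubring C(X, 𝕜)} (hA : IsNormalSubring A)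
    {K L : Set (StoneCech X)} (hK : IsClosed K) (hL : IsClosed L) (hKL : Disjoint K L) :
    ∃ a ∈ A, (∀ x, stoneCechUnit x ∈ K → a x = 1) ∧ (∀ x, stoneCechUnit x ∈ L → a x = 0) := by
  obtain ⟨a, ha, -, h1, h0⟩ := hA K L hK hL hKL
  refine ⟨a, ha, fun x hx => ?_, fun x hx => ?_⟩
  · simpa [OnePoint.coe_eq_coe] using h1 _ hx
  · simpa [OnePoint.coe_eq_coe] using h0 _ hx

variable {E : Type*} [NormedAddCommGroup E]

theorem IsNormalLocalModule.admitsCutoffs [NormedSpace 𝕜 E] {M : AddSubgroup C(X, E)}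
    (hM : IsNormalLocalModule 𝕜 M) : AdmitsCutoffs M := by
  obtain ⟨A, hA, -, hAM, -⟩ := hM
  intro f hf K L hK hL hKL
  obtain ⟨a, ha, h1, h0⟩ := hA.exists_bump hK hL hKL
  refine ⟨a • f, hAM a ha f hf, fun x hx => ?_, fun x hx => ?_, fun x hx => ?_⟩
  · simp [hx]
  · simp [h1 x hx]
  · simp [h0 x hx]

theorem IsNormalLocalModule.nowhereVanishing [NormedSpace 𝕜 E] {M : AddSubgroup C(X, E)}
    (hM : IsNormalLocalModule 𝕜 M) : NowhereVanishing M := by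
  obtain ⟨A, -, -, -, hne⟩ := hM
  exact hne

theorem exists_bump_of_isClosed {K L : Set (StoneCech X)} (hK : IsClosed K) (hL : IsClosed L)
    (hKL : Disjoint K L) :
    ∃ a : C(X, ℝ), (∀ x, stoneCechUnit x ∈ K → a x = 1) ∧
      (∀ x, stoneCechUnit x ∈ L → a x = 0) ∧ ∀ x, |a x| ≤ 1 := by
  obtain ⟨b, h0, h1, hb⟩ := exists_continuous_zero_one_of_isClosed hL hK hKL.symm
  refine ⟨b.comp ⟨stoneCechUnit, continuous_stoneCechUnit⟩, fun x hx => h1 hx,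
    fun x hx => h0 hx, fun x => ?_⟩
  have hx := hb (stoneCechUnit x)
  exact abs_le.2 ⟨(neg_one_lt_zero.le).trans hx.1, hx.2⟩

theorem admitsCutoffs_boundedMaps [NormedSpace ℝ E] : AdmitsCutoffs (boundedMaps X E) := by
  rintro f ⟨C, hC⟩ K L hK hL hKL
  obtain ⟨a, h1, h0, ha⟩ := exists_bump_of_isClosed hK hL hKL
  refine ⟨a • f, ⟨C, fun x => ?_⟩, fun x hx => ?_, fun x hx => ?_, fun x hx => ?_⟩
  · calc ‖(a • f) x‖ = |a x| * ‖f x‖ := by simp [norm_smul]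
      _ ≤ 1 * ‖f x‖ := by gcongr; exact ha x
      _ ≤ C := by rw [one_mul]; exact hC x
  · simp [hx]
  · simp [h1 x hx]
  · simp [h0 x hx]

theorem const_mem_boundedMaps (v : E) : ContinuousMap.const X v ∈ boundedMaps X E :=
  ⟨‖v‖, fun _ => le_rfl⟩

theorem nowhereVanishing_boundedMaps [Nontrivial E] : NowhereVanishing (boundedMaps X E) := by
  obtain ⟨v, hv⟩ := exists_ne (0 : E)
  exact fun x => ⟨_, const_mem_boundedMaps v, hv⟩

end Modules

/-! ### Points of `Y` go to points where real functions stay finite -/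

section FinitePoints

variable {X Y E F : Type*} [TopologicalSpace X] [TopologicalSpace Y]
  [NormedAddCommGroup E] [NormedAddCommGroup F]

theorem betaExt_supportMap_ne_infty_of_isNormalLocalModule {𝕜 : Type*} [RCLike 𝕜]
    [NormedSpace 𝕜 E] [NormedSpace ℝ F] [CompletelyRegularSpace Y]
    {M : AddSubgroup C(X, E)} {N : AddSubgroup C(Y, F)}
    (hM : IsNormalLocalModule 𝕜 M) (hN : NowhereVanishing N) {T : M →+ N}
    (hT : PreservesDisjointness T) (hTs : Function.Surjective T)
    (H : StoneCech Y ≃ₜ StoneCech X) (hH : IsSupportMap T fun y => H (stoneCechUnit y))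
    (y : Y) (u : C(X, ℝ)) : betaExt u (H (stoneCechUnit y)) ≠ OnePoint.infty := by
  intro hu
  obtain ⟨G, P, hGP, hcl⟩ := exists_isShellFamily hu
  obtain ⟨A, hA, hAloc, hAM, -⟩ := hM
  obtain ⟨k, hkN, hky⟩ := hN y
  obtain ⟨f, hf⟩ := hTs ⟨k, hkN⟩
  choose a haA ha1 ha0 using fun m => hA.exists_bump (K := closure (G m)) (L := (P m)ᶜ)
    isClosed_closure (hGP.isOpen_outer m).isClosed_compl
    (Set.disjoint_compl_right_iff_subset.2 (hGP.closure_subset m))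
  obtain ⟨b, hb, hbloc⟩ := hGP.exists_glue (fun m => m • a m) (fun m x hx => by simp [ha0 m x hx])
  have hbA : b ∈ A := hAloc b fun x => by
    obtain ⟨U, hU, hxU, m, hm⟩ := hbloc x
    exact ⟨U, hU, hxU, m • a m, nsmul_mem (haA m) m, hm⟩
  let g : M := ⟨b • (f : C(X, E)), hAM b hbA f f.2⟩
  have hg : ∀ m z, H (stoneCechUnit z) ∈ G m → (T g : C(Y, F)) z = m • k z := by
    intro m z hz
    -- Integer values of `b` are essential: `T` is only additive.
    have := hH.map_congr hT (f := g) (g := m • f) (hGP.isOpen_inner m) (fun x hx => by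
      have h1 : b x = m := by
        simp [hb m x (hGP.closure_subset m (subset_closure hx)), ha1 m x (subset_closure hx)]
      simp [g, h1, Nat.cast_smul_eq_nsmul]) hz
    simpa [map_nsmul, hf] using this
  obtain ⟨n, hn⟩ := exists_nat_gt ((‖(T g : C(Y, F)) y‖ + 1) / (‖k y‖ / 2))
  have hk0 : 0 < ‖k y‖ := norm_pos_iff.2 hky
  have hW1 : IsOpen {z | ‖k y‖ / 2 < ‖k z‖} := isOpen_lt continuous_const (by fun_prop)
  have hW2 : IsOpen {z | ‖(T g : C(Y, F)) z‖ < ‖(T g : C(Y, F)) y‖ + 1} :=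
    isOpen_lt (by fun_prop) continuous_const
  obtain ⟨z, ⟨hz1, hz2⟩, hz3⟩ := mem_closure_iff.1 (mem_closure_preimage_of_homeomorph H
    (isOpen_biUnion fun m _ => hGP.isOpen_inner m) (hcl n)) _ (hW1.inter hW2)
    ⟨half_lt_self hk0, lt_add_one ‖(T g : C(Y, F)) y‖⟩
  obtain ⟨m, hm, hzm⟩ := Set.mem_iUnion₂.1 hz3
  have hmn : (n : ℝ) ≤ m := by exact_mod_cast hm
  rw [Set.mem_ofPred_eq, hg m z hzm, ← Nat.cast_smul_eq_nsmul ℝ, norm_smul] at hz2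
  rw [div_lt_iff₀ (half_pos hk0)] at hn
  have h1 : (n : ℝ) * (‖k y‖ / 2) ≤ m * ‖k z‖ :=
    mul_le_mul hmn (le_of_lt hz1) (half_pos hk0).le m.cast_nonneg
  have h2 : ‖(m : ℝ)‖ = m := by simp
  rw [h2] at hz2
  linarith

theorem betaExt_supportMap_ne_infty_of_boundedMaps [NormedSpace ℝ E] [NormedSpace ℝ F]
    [CompletelyRegularSpace Y] (e : boundedMaps X E ≃+ boundedMaps Y F)
    (he : PreservesDisjointness (e : boundedMaps X E →+ boundedMaps Y F))
    (he' : PreservesDisjointness (e.symm : boundedMaps Y F →+ boundedMaps X E))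
    (H : StoneCech Y ≃ₜ StoneCech X)
    (hH : IsSupportMap (e : boundedMaps X E →+ boundedMaps Y F) fun y => H (stoneCechUnit y))
    (hH' : IsSupportMap (e.symm : boundedMaps Y F →+ boundedMaps X E)
      fun x => H.symm (stoneCechUnit x))
    {R : ℝ} {w : ℕ → F} (hwR : ∀ n, ‖w n‖ ≤ R) (hw : Pairwise fun m n => 1 ≤ ‖w m - w n‖)
    (y : Y) (u : C(X, ℝ)) : betaExt u (H (stoneCechUnit y)) ≠ OnePoint.infty := by
  intro hu
  obtain ⟨G, P, hGP, hcl⟩ := exists_isShellFamily hu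
  choose O hO hGO hOP using fun m => normal_exists_closure_subset isClosed_closure
    (hGP.isOpen_outer m) (hGP.closure_subset m)
  let c : ℕ → boundedMaps Y F := fun m => ⟨ContinuousMap.const Y (w m), const_mem_boundedMaps _⟩
  let f : ℕ → boundedMaps X E := fun m => e.symm (c m)
  -- The bound `4 ^ n` leaves growth `2 ^ n` after the constants are scaled by `2⁻ⁿ`.
  by_cases hcase : ∀ n : ℕ, ∃ᶠ m in Filter.atTop, ∃ x, stoneCechUnit x ∈ O m ∧
      (4 : ℝ) ^ n < ‖(f m : C(X, E)) x‖
  · obtain ⟨φ, hφ, hφf⟩ := Filter.extraction_forall_of_frequently hcase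
    choose x hxO hxf using hφf
    choose b hb1 hb0 hb using fun n => exists_bump_of_isClosed
      (K := H ⁻¹' closure (O (φ n))) (L := (H ⁻¹' P (φ n))ᶜ)
      (isClosed_closure.preimage H.continuous)
      ((hGP.isOpen_outer _).preimage H.continuous).isClosed_compl
      (Set.disjoint_compl_right_iff_subset.2 (Set.preimage_mono (hOP _)))
    have hR : 0 ≤ R := (norm_nonneg _).trans (hwR 0)
    let t : ℕ → C(Y, F) := fun n => ((1 / 2 : ℝ) ^ n) • b n • ContinuousMap.const Y (w (φ n))
    have htP : ∀ n z, t n z ≠ 0 → H (stoneCechUnit z) ∈ P (φ n) := fun n z hz => by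
      by_contra hzP
      exact hz (by simp [t, hb0 n z hzP])
    have htn : ∀ n z, ‖t n z‖ ≤ (1 / 2 : ℝ) ^ n * R := fun n z => by
      calc ‖t n z‖ = (1 / 2 : ℝ) ^ n * (|b n z| * ‖w (φ n)‖) := by simp [t, norm_smul]
        _ ≤ (1 / 2 : ℝ) ^ n * (1 * R) := by
          gcongr
          exacts [hb n z, hwR _]
        _ = _ := by rw [one_mul]
    -- Local finiteness of the shells is known in `X` only; in `Y`, uniform convergence provides
    -- continuity.
    obtain ⟨g, hg⟩ := exists_continuousMap_of_disjoint t _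
      (by simpa using (tendsto_pow_atTop_nhds_zero_of_lt_one (r := (1 / 2 : ℝ)) (by norm_num)
        (by norm_num)).mul_const R) htn
      (fun m n z hm hn => hφ.injective (hGP.disjoint _ _ _ (htP m z hm) (htP n z hn)))
    have hgB : g ∈ boundedMaps Y F := ⟨R, fun z => by
      by_cases hex : ∃ n, t n z ≠ 0
      · obtain ⟨n, hn⟩ := hex
        rw [(hg z).1 n hn]
        exact (htn n z).trans (mul_le_of_le_one_left hR (pow_le_one₀ (by norm_num) (by norm_num)))
      · push Not at hex
        rw [(hg z).2 hex, norm_zero]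
        exact hR⟩
    have hgO : ∀ n z, H (stoneCechUnit z) ∈ O (φ n) → (2 ^ n) • g z = w (φ n) := by
      intro n z hz
      have hb1' := hb1 n z (subset_closure hz)
      have htz : t n z = ((1 / 2 : ℝ) ^ n) • w (φ n) := by simp [t, hb1']
      have hgz : g z = t n z := by
        by_cases h0 : t n z = 0
        · rw [h0]
          refine (hg z).2 fun m => ?_
          by_contra hm
          have := hGP.disjoint _ _ _ (htP m z hm) (hOP _ (subset_closure hz))
          exact hm (hφ.injective this ▸ h0)
        · exact (hg z).1 n h0
      rw [hgz, htz, ← Nat.cast_smul_eq_nsmul ℝ, smul_smul]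
      simp
    obtain ⟨C, hC⟩ := (e.symm ⟨g, hgB⟩).2
    have hlow : ∀ n : ℕ, (2 : ℝ) ^ n ≤ C := by
      intro n
      have h1 := hH'.map_congr he' (f := 2 ^ n • ⟨g, hgB⟩) (g := c (φ n))
        ((hO (φ n)).preimage H.continuous) (fun z hz => by simpa [c] using hgO n z hz)
        (y := x n) (by simpa using hxO n)
      have h2 := hxf n
      have h3 : (f (φ n) : C(X, E)) (x n) = 2 ^ n • (e.symm ⟨g, hgB⟩ : C(X, E)) (x n) := by
        refine h1.symm.trans ?_
        rw [map_nsmul]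
        rfl
      rw [h3, ← Nat.cast_smul_eq_nsmul ℝ, norm_smul] at h2
      have h4 : (4 : ℝ) ^ n = 2 ^ n * 2 ^ n := by rw [← mul_pow]; norm_num
      have h5 : ‖((2 ^ n : ℕ) : ℝ)‖ = 2 ^ n := by simp
      rw [h4, h5] at h2
      exact (lt_of_mul_lt_mul_left h2 (by positivity)).le.trans (hC _)
    obtain ⟨n, hn⟩ := pow_unbounded_of_one_lt C (one_lt_two (α := ℝ))
    exact (hlow n).not_gt hn
  · push Not at hcase
    obtain ⟨n, hn⟩ := hcase
    obtain ⟨N, hN⟩ := Filter.eventually_atTop.1 hn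
    choose a ha1 ha0 ha using fun m => exists_bump_of_isClosed
      (K := closure (G m)) (L := (O m)ᶜ) isClosed_closure (hO m).isClosed_compl
      (Set.disjoint_compl_right_iff_subset.2 (hGO m))
    obtain ⟨g, hg, hgloc⟩ := hGP.exists_glue
      (fun m => if N ≤ m then a m • (f m : C(X, E)) else 0) (fun m x hx => by
        split_ifs
        · simp [ha0 m x fun h => hx (hOP m (subset_closure h))]
        · rfl)
    have hgB : g ∈ boundedMaps X E := ⟨4 ^ n, fun x => by
      obtain ⟨U, -, hxU, m, hm⟩ := hgloc x
      rw [hm x hxU]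
      split_ifs with hNm
      · by_cases hx : stoneCechUnit x ∈ O m
        · calc ‖(a m • (f m : C(X, E))) x‖ = |a m x| * ‖(f m : C(X, E)) x‖ := by simp [norm_smul]
            _ ≤ 1 * 4 ^ n := by
              gcongr
              exacts [ha m x, hN m hNm x hx]
            _ = 4 ^ n := one_mul _
        · simp [ha0 m x hx]
      · simp⟩
    have hgw : ∀ m ≥ N, ∀ z, H (stoneCechUnit z) ∈ G m → (e ⟨g, hgB⟩ : C(Y, F)) z = w m := by
      intro m hm z hz
      have := hH.map_congr he (f := ⟨g, hgB⟩) (g := f m) (hGP.isOpen_inner m) (fun x hx => by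
        have hx' := subset_closure hx
        simp [hg m x (hGP.closure_subset m hx'), hm, ha1 m x hx']) hz
      simpa [f, c] using this
    have hclose : ∀ k ≥ N, ∃ m ≥ k, ‖w m - (e ⟨g, hgB⟩ : C(Y, F)) y‖ < 1 / 2 := by
      intro k hk
      have hW : IsOpen {z | ‖(e ⟨g, hgB⟩ : C(Y, F)) z - (e ⟨g, hgB⟩ : C(Y, F)) y‖ < 1 / 2} :=
        isOpen_lt (by fun_prop) continuous_const
      obtain ⟨z, hz, hzG⟩ := mem_closure_iff.1 (mem_closure_preimage_of_homeomorph H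
        (isOpen_biUnion fun m _ => hGP.isOpen_inner m) (hcl k)) _ hW (by simp)
      obtain ⟨m, hm, hzm⟩ := Set.mem_iUnion₂.1 hzG
      refine ⟨m, hm, ?_⟩
      rw [← hgw m (hk.trans hm) z hzm]
      exact hz
    -- Two distinct indices put two 1-separated vectors within `1/2` of the same value.
    obtain ⟨m, hm, hmw⟩ := hclose N le_rfl
    obtain ⟨m', hm', hmw'⟩ := hclose (m + 1) (by omega)
    have h1 : 1 ≤ ‖w m - w m'‖ := hw (by omega)
    have h2 := norm_sub_le_norm_sub_add_norm_sub (w m) ((e ⟨g, hgB⟩ : C(Y, F)) y) (w m')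
    rw [norm_sub_rev ((e ⟨g, hgB⟩ : C(Y, F)) y) (w m')] at h2
    linarith

end FinitePoints

/-! ### Assembly of the theorem -/

theorem IsSeparating.preservesDisjointness {X Y E F : Type*} [TopologicalSpace X]
    [TopologicalSpace Y] [NormedAddCommGroup E] [NormedAddCommGroup F]
    {M : AddSubgroup C(X, E)} {N : AddSubgroup C(Y, F)} {T : M →+ N} (hT : IsSeparating T) :
    PreservesDisjointness T := by
  intro f g hfg y
  by_contra! hy
  have h0 : cozeroSet (f : C(X, E)) ∩ cozeroSet (g : C(X, E)) = ∅ :=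
    Set.eq_empty_of_forall_notMem fun x hx => (hfg x).elim hx.1 hx.2
  exact (Set.eq_empty_iff_forall_notMem.1 (hT.disjoint f g h0)) y hy

theorem exists_homeomorph_isSupportMap {X Y E F : Type*} [TopologicalSpace X]
    [TopologicalSpace Y] [NormedAddCommGroup E] [NormedAddCommGroup F]
    {M : AddSubgroup C(X, E)} {N : AddSubgroup C(Y, F)}
    (hM : AdmitsCutoffs M) (hN : AdmitsCutoffs N) (hM' : NowhereVanishing M)
    (hN' : NowhereVanishing N) (e : M ≃+ N) (he : PreservesDisjointness (e : M →+ N))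
    (he' : PreservesDisjointness (e.symm : N →+ M)) :
    ∃ H : StoneCech Y ≃ₜ StoneCech X,
      (IsSupportMap (e : M →+ N) fun y => H (stoneCechUnit y)) ∧
      IsSupportMap (e.symm : N →+ M) fun x => H.symm (stoneCechUnit x) := by
  obtain ⟨h, hh⟩ := exists_isSupportMap (T := (e : M →+ N)) hM hN' e.surjective
  obtain ⟨k, hk⟩ := exists_isSupportMap (T := (e.symm : N →+ M)) hN hM' e.symm.surjective
  refine ⟨⟨⟨stoneCechExtend (hh.continuous he), stoneCechExtend (hk.continuous he'),
    stoneCechExtend_supportMap_leftInverse e he he' hN hh hk,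
    stoneCechExtend_supportMap_leftInverse e.symm he' he hM hk hh⟩,
    continuous_stoneCechExtend _, continuous_stoneCechExtend _⟩, ?_, ?_⟩
  · convert hh using 2
    exact stoneCechExtend_stoneCechUnit (hh.continuous he) _
  · convert hk using 2
    exact stoneCechExtend_stoneCechUnit (hk.continuous he') _

theorem theorem3p4 {𝕜 : Type*} [RCLike 𝕜]
    {X Y : Type*} [TopologicalSpace X] [T35Space X] [TopologicalSpace Y] [T35Space Y]
    {E F : Type*} [NormedAddCommGroup E] [NormedSpace 𝕜 E]
    [NormedAddCommGroup F] [NormedSpace 𝕜 F]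
    (M : AddSubgroup C(X, E)) (N : AddSubgroup C(Y, F))
    (hMN : (IsNormalLocalModule 𝕜 M ∧ IsNormalLocalModule 𝕜 N) ∨
      ((¬ FiniteDimensional 𝕜 E ∧ ¬ FiniteDimensional 𝕜 F) ∧
        M = boundedMaps X E ∧ N = boundedMaps Y F))
    (T : M → N) (hT : IsBiseparating T) :
    Nonempty (HewittRealcompactification X ≃ₜ HewittRealcompactification Y) := by
  obtain ⟨hbij, hsep, hsep'⟩ := hT
  let _ : NormedSpace ℝ E := NormedSpace.restrictScalars ℝ 𝕜 E
  let _ : NormedSpace ℝ F := NormedSpace.restrictScalars ℝ 𝕜 F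
  let e : M ≃+ N := { Equiv.ofBijective T hbij with map_add' := hsep.map_add }
  have he : PreservesDisjointness (e : M →+ N) :=
    IsSeparating.preservesDisjointness (T := (e : M →+ N)) hsep
  have he' : PreservesDisjointness (e.symm : N →+ M) :=
    IsSeparating.preservesDisjointness (T := (e.symm : N →+ M)) hsep'
  clear_value e
  rcases hMN with ⟨hM, hN⟩ | ⟨⟨hE, hF⟩, rfl, rfl⟩
  · obtain ⟨H, hH, hH'⟩ := exists_homeomorph_isSupportMap hM.admitsCutoffs hN.admitsCutoffs
      hM.nowhereVanishing hN.nowhereVanishing e he he'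
    exact nonempty_homeomorph_hewittRealcompactification H
      (betaExt_supportMap_ne_infty_of_isNormalLocalModule hM hN.nowhereVanishing he e.surjective
        H hH)
      (betaExt_supportMap_ne_infty_of_isNormalLocalModule hN hM.nowhereVanishing he'
        e.symm.surjective H.symm hH')
  · obtain ⟨R, v, -, hvR, hv⟩ := exists_seq_norm_le_one_le_norm_sub hE
    obtain ⟨R', w, -, hwR, hw⟩ := exists_seq_norm_le_one_le_norm_sub hF
    have : Nontrivial E := ⟨v 0, v 1, fun h => by
      have := hv zero_ne_one
      norm_num [h] at this⟩
    have : Nontrivial F := ⟨w 0, w 1, fun h => by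
      have := hw zero_ne_one
      norm_num [h] at this⟩
    obtain ⟨H, hH, hH'⟩ := exists_homeomorph_isSupportMap admitsCutoffs_boundedMaps
      admitsCutoffs_boundedMaps nowhereVanishing_boundedMaps nowhereVanishing_boundedMaps e he he'
    exact nonempty_homeomorph_hewittRealcompactification H
      (betaExt_supportMap_ne_infty_of_boundedMaps e he he' H hH hH' hwR hw)
      (betaExt_supportMap_ne_infty_of_boundedMaps e.symm he' he H.symm hH' hH hvR hv)
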